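/- For a partition $\pi$ of $N$, let $[\pi]$ denote the irreducible complex representation of the symmetric group $\mathfrak S_N$ corresponding to $\pi$ (the Specht module of shape $\pi$, so that $[(N)]$ is the trivial representation and $[(1^N)]$ is the sign representation). Partitions that differ only by zero parts are identified. Let $m,n,N$ be non-negative integers, let $\gamma$ be a partition of $N$ with at most $mn$ non-zero parts, and let $t=(t_{ij})_{1\le i\le m,\,1\le j\le n}$ be an $m\times n$ tableau filled with the parts of $\gamma$, each part used once, with the remaining boxes filled by zeros. Assume that the entries of $t$ weakly decrease along every row and along every column. Let $\alpha$ and $\beta$ be the partitions of $N$ whose parts are the row sums and the column sums of $t$, respectively: $$\alpha_i=\sum_{j=1}^n t_{ij}\quad(1\le i\le m),\qquad \beta_j=\sum_{i=1}^m t_{ij}\quad(1\le j\le n).$$ Then $[\gamma]$ appears in $[\alpha]\otimes[\beta]$ (with the diagonal action of $\mathfrak S_N$): there is an injective $\mathfrak S_N$-equivariant linear map $[\gamma]\to[\alpha]\otimes[\beta]$. -/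

import Mathlib

/-- The Young diagram of a partition: the `i`-th row has as many cells as the `i`-th largest part
(rows and columns are indexed from `0`). -/
def partitionDiagram {N : ℕ} (p : N.Partition) : YoungDiagram :=
  YoungDiagram.ofRowLens (p.parts.sort (· ≥ ·)) (p.parts.pairwise_sort (· ≥ ·)).sortedGE

/-- The parts of `p` are the non-zero values of the finite family `f`, with multiplicities: `p` and
`f` differ only by the order and by zero parts. -/
def PartsAre {N : ℕ} {ι : Type*} [Fintype ι] (p : N.Partition) (f : ι → ℕ) : Prop :=
  p.parts = (Finset.univ.val.map f).filter (· ≠ 0)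

/-- A Young tableau of shape `μ` with entries `0, …, N - 1`, each used once. -/
abbrev BijTableau (μ : YoungDiagram) (N : ℕ) : Type := {c // c ∈ μ.cells} ≃ Fin N

/-- A tabloid of shape `μ` with entries `0, …, N - 1`: a tableau up to permutations of the entries
within the rows. It is given by the map which sends an entry to the index of its row. -/
def Tabloid (μ : YoungDiagram) (N : ℕ) : Type :=
  {r : Fin N → ℕ // ∀ i, (Finset.univ.filter fun x => r x = i).card = μ.rowLen i}

/-- `Equiv.Perm (Fin N)` acts on tabloids by permuting the entries: after the action of `σ`, the
entry `σ x` stands in the row where `x` stood. -/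
instance Tabloid.instMulAction (μ : YoungDiagram) (N : ℕ) :
    MulAction (Equiv.Perm (Fin N)) (Tabloid μ N) where
  smul σ r := ⟨fun x => r.1 (σ⁻¹ x), fun i => by
    rw [← r.2 i]
    refine Finset.card_bij (fun x _ => σ⁻¹ x) ?_ ?_ ?_
    · intro x hx
      simpa using hx
    · intro x _ y _ h
      exact σ⁻¹.injective h
    · intro y hy
      exact ⟨σ y, by simpa using hy, by simp⟩⟩
  one_smul _ := rfl
  mul_smul σ τ r := Subtype.ext (funext fun x => by
    change r.1 ((σ * τ)⁻¹ x) = r.1 (τ⁻¹ (σ⁻¹ x))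
    rw [mul_inv_rev, Equiv.Perm.mul_apply])

/-- The tabloid of a tableau. -/
def BijTableau.tabloid {μ : YoungDiagram} {N : ℕ} (T : BijTableau μ N) : Tabloid μ N :=
  ⟨fun x => (T.symm x).1.1, fun i => by
    rw [YoungDiagram.rowLen_eq_card]
    refine Finset.card_bij (fun x _ => (T.symm x).1) ?_ ?_ ?_
    · intro x hx
      rw [YoungDiagram.mem_row_iff]
      exact ⟨(T.symm x).2, by simpa using hx⟩
    · intro x _ y _ h
      exact T.symm.injective (Subtype.ext h)
    · intro c hc
      rw [YoungDiagram.mem_row_iff] at hc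
      exact ⟨T ⟨c, hc.1⟩, by simpa using hc.2, by simp⟩⟩

/-- The column group of a tableau: the permutations of the entries that keep every entry in its
column. -/
def BijTableau.columnGroup {μ : YoungDiagram} {N : ℕ} (T : BijTableau μ N) :
    Finset (Equiv.Perm (Fin N)) :=
  Finset.univ.filter fun σ => ∀ x, (T.symm (σ x)).1.2 = (T.symm x).1.2

/-- The permutation representation of the symmetric group on the tabloids of shape `μ`, over `ℂ`. -/
noncomputable abbrev tabloidRep (μ : YoungDiagram) (N : ℕ) :
    Representation ℂ (Equiv.Perm (Fin N)) (MonoidAlgebra ℂ (Tabloid μ N)) :=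
  Representation.ofMulAction ℂ (Equiv.Perm (Fin N)) (Tabloid μ N)

/-- The polytabloid of a tableau `T`: the signed sum of the tabloids `σ • {T}` over the column
group of `T`. -/
noncomputable def BijTableau.polytabloid {μ : YoungDiagram} {N : ℕ} (T : BijTableau μ N) :
    MonoidAlgebra ℂ (Tabloid μ N) :=
  ∑ σ ∈ T.columnGroup, MonoidAlgebra.single (σ • T.tabloid) ((Equiv.Perm.sign σ : ℤ) : ℂ)

theorem BijTableau.tabloid_trans {μ : YoungDiagram} {N : ℕ} (T : BijTableau μ N)
    (g : Equiv.Perm (Fin N)) : BijTableau.tabloid (T.trans g) = g • T.tabloid := rfl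

theorem BijTableau.tabloidRep_polytabloid {μ : YoungDiagram} {N : ℕ} (g : Equiv.Perm (Fin N))
    (T : BijTableau μ N) :
    tabloidRep μ N g T.polytabloid = BijTableau.polytabloid (T.trans g) := by
  unfold BijTableau.polytabloid
  rw [map_sum]
  refine Finset.sum_bij (fun σ _ => g * σ * g⁻¹) ?_ ?_ ?_ ?_
  · intro σ hσ
    simp only [BijTableau.columnGroup, Finset.mem_filter, Finset.mem_univ, true_and] at hσ ⊢
    intro x
    have h := hσ (g⁻¹ x)
    change (T.symm (g⁻¹ (g (σ (g⁻¹ x))))).1.2 = (T.symm (g⁻¹ x)).1.2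
    rw [show ∀ y, g⁻¹ (g y) = y from g.symm_apply_apply]
    exact h
  · intro σ _ τ _ h
    exact mul_left_cancel (mul_right_cancel h)
  · intro τ hτ
    refine ⟨g⁻¹ * τ * g, ?_, by group⟩
    simp only [BijTableau.columnGroup, Finset.mem_filter, Finset.mem_univ, true_and] at hτ ⊢
    intro x
    have h := hτ (g x)
    change (T.symm (g⁻¹ (τ (g x)))).1.2 = (T.symm (g⁻¹ (g x))).1.2 at h
    rw [show ∀ y, g⁻¹ (g y) = y from g.symm_apply_apply] at h
    exact h
  · intro σ _
    rw [Representation.ofMulAction_single, BijTableau.tabloid_trans]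
    congr 1
    · simp only [← mul_smul]
      congr 1
      group
    · simp [mul_right_comm]

/-- The Specht module of shape `μ`: the span of the polytabloids of all tableaux of shape `μ`. -/
noncomputable def spechtSubrep (μ : YoungDiagram) (N : ℕ) :
    Subrepresentation (tabloidRep μ N) where
  toSubmodule := Submodule.span ℂ (Set.range fun T : BijTableau μ N => T.polytabloid)
  apply_mem_toSubmodule g v hv := by
    induction hv using Submodule.span_induction with
    | mem x hx =>
      obtain ⟨T, rfl⟩ := hx
      exact Submodule.subset_span ⟨T.trans g, (T.tabloidRep_polytabloid g).symm⟩
    | zero => rw [map_zero]; exact Submodule.zero_mem _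
    | add x y _ _ hx hy => rw [map_add]; exact Submodule.add_mem _ hx hy
    | smul a x _ hx => rw [map_smul]; exact Submodule.smul_mem _ a hx

/-- The irreducible complex representation `[p]` of the symmetric group on `N` letters that
corresponds to the partition `p` of `N`, as a Specht module: `[(N)]` is the trivial representation
and `[(1, …, 1)]` is the sign. -/
noncomputable def spechtRep {N : ℕ} (p : N.Partition) :
    Representation ℂ (Equiv.Perm (Fin N)) (spechtSubrep (partitionDiagram p) N).toSubmodule :=
  (spechtSubrep (partitionDiagram p) N).toRepresentation

/-- `ρ` appears in `τ`: there is an injective equivariant linear map from `ρ` to `τ`. (For an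
irreducible `ρ`, this means multiplicity at least one.) -/
def AppearsIn {G V W : Type*} [Group G] [AddCommMonoid V] [Module ℂ V] [AddCommMonoid W] [Module ℂ W]
    (ρ : Representation ℂ G V) (τ : Representation ℂ G W) : Prop :=
  ∃ f : ρ.IntertwiningMap τ, Function.Injective f

/-!
Stack `t i j` boxes over the position `(i, j)` and let `Fin N` enumerate the boxes `(i, j, k)`,
`k < t i j`. Since `t` is decreasing in both directions, the boxes form three tableaux: `A` of shape
`α` with rows `i = const` and columns the lines in direction `i`, `B` of shape `β` likewise for `j`,
and `T` of shape `γ` with rows the vertical lines and columns the layers `k = const`.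

Let `a` and `b` be the tabloids of `A` and `B`, and `p`, `q` equivariant projections of the
permutation modules onto the Specht modules `[α]`, `[β]`. The row group of `T` fixes `p a ⊗ q b`, so
there is an equivariant map from the permutation module of `γ` that takes the tabloid of `T` to
`p a ⊗ q b`; as `[γ]` is irreducible, it is injective on `[γ]` once the signed sum `κ` over the
column group of `T` does not kill `p a ⊗ q b`. The column group of `A` lies in that of `T` and fixes
`b`, and its signed sum sends `a` to a polytabloid, which `p` fixes, so it cannot tell `p a` from
`a`; symmetrically for `B`. Hence `κ (p a ⊗ q b) = κ (a ⊗ b)`, and this is a signed sum of distinct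
basis vectors, because a permutation that preserves `i`, `j` and `k` is trivial.
-/

open Equiv.Perm MulAction Representation
open scoped TensorProduct

section Antisymmetrizer

variable {ι k V W : Type*} [Fintype ι] [DecidableEq ι] [CommRing k] [AddCommGroup V] [Module k V]
  [AddCommGroup W] [Module k W] {ρ : Representation k (Equiv.Perm ι) V}
  {τ : Representation k (Equiv.Perm ι) W} {H K : Subgroup (Equiv.Perm ι)}

open Classical in
/-- The action of the signed sum of the elements of the permutation group `H` on a representation
of the symmetric group. -/
noncomputable def antisymmetrizer (H : Subgroup (Equiv.Perm ι))
    (ρ : Representation k (Equiv.Perm ι) V) : V →ₗ[k] V :=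
  ∑ σ : H, sign (σ : Equiv.Perm ι) • ρ σ

open Classical in
theorem antisymmetrizer_apply (v : V) :
    antisymmetrizer H ρ v = ∑ σ : H, sign (σ : Equiv.Perm ι) • ρ σ v := by
  simp [antisymmetrizer]

theorem map_antisymmetrizer (f : ρ.IntertwiningMap τ) (v : V) :
    f (antisymmetrizer H ρ v) = antisymmetrizer H τ (f v) := by
  simp [antisymmetrizer_apply, Units.smul_def, f.isIntertwining]

theorem antisymmetrizer_mem (U : Subrepresentation ρ) {v : V} (hv : v ∈ U.toSubmodule) :
    antisymmetrizer H ρ v ∈ U.toSubmodule := by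
  classical
  rw [antisymmetrizer_apply]
  exact sum_mem fun σ _ => zsmul_mem (U.apply_mem_toSubmodule σ hv) _

theorem antisymmetrizer_apply_of_mem {g : Equiv.Perm ι} (hg : g ∈ H) (v : V) :
    antisymmetrizer H ρ (ρ g v) = sign g • antisymmetrizer H ρ v := by
  classical
  simp only [antisymmetrizer_apply, Finset.smul_sum]
  refine Fintype.sum_equiv (Equiv.mulRight ⟨g, hg⟩) _ _ fun σ => ?_
  simp [smul_smul, mul_comm (sign g), mul_assoc, map_mul]

theorem antisymmetrizer_antisymmetrizer (hKH : K ≤ H) (v : V) :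
    antisymmetrizer H ρ (antisymmetrizer K ρ v) = Nat.card K • antisymmetrizer H ρ v := by
  classical
  have map_term (σ : K) : antisymmetrizer H ρ (sign (σ : Equiv.Perm ι) • ρ σ v) =
      antisymmetrizer H ρ v := by
    rw [Units.smul_def, map_zsmul, ← Units.smul_def, antisymmetrizer_apply_of_mem (hKH σ.2),
      smul_smul, Int.units_mul_self, one_smul]
  simp [antisymmetrizer_apply (H := K), map_sum, map_term]

theorem antisymmetrizer_congr_of_le [IsAddTorsionFree V] (hKH : K ≤ H) {v w : V}
    (h : antisymmetrizer K ρ v = antisymmetrizer K ρ w) :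
    antisymmetrizer H ρ v = antisymmetrizer H ρ w := by
  have := congrArg (antisymmetrizer H ρ) h
  simp only [antisymmetrizer_antisymmetrizer hKH] at this
  exact nsmul_right_injective Nat.card_pos.ne' this

theorem antisymmetrizer_eq_zero_of_swap [IsAddTorsionFree V] {x y : ι} (hxy : x ≠ y)
    (hH : Equiv.swap x y ∈ H) {v : V} (hv : ρ (Equiv.swap x y) v = v) :
    antisymmetrizer H ρ v = 0 := by
  have eq_neg := antisymmetrizer_apply_of_mem (ρ := ρ) hH v
  rw [hv, sign_swap hxy, Units.neg_smul, one_smul] at eq_neg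
  exact self_eq_neg.mp eq_neg

theorem antisymmetrizer_tmul_of_fixed_right (v : V) {w : W} (hw : ∀ σ ∈ H, τ σ w = w) :
    antisymmetrizer H (ρ.tprod τ) (v ⊗ₜ[k] w) = antisymmetrizer H ρ v ⊗ₜ[k] w := by
  simp [antisymmetrizer_apply, Units.smul_def, TensorProduct.sum_tmul,
    TensorProduct.smul_tmul', hw]

theorem antisymmetrizer_tmul_of_fixed_left {v : V} (w : W) (hv : ∀ σ ∈ H, ρ σ v = v) :
    antisymmetrizer H (ρ.tprod τ) (v ⊗ₜ[k] w) = v ⊗ₜ[k] antisymmetrizer H τ w := by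
  simp [antisymmetrizer_apply, Units.smul_def, TensorProduct.tmul_sum, hv]

theorem antisymmetrizer_tmul_congr [IsAddTorsionFree (V ⊗[k] W)] {K' : Subgroup (Equiv.Perm ι)}
    (hKH : K ≤ H) (hK'H : K' ≤ H) {v v' : V} {w w' : W}
    (hv : antisymmetrizer K ρ v = antisymmetrizer K ρ v') (hw : ∀ σ ∈ K, τ σ w = w)
    (hw' : antisymmetrizer K' τ w = antisymmetrizer K' τ w') (hv' : ∀ σ ∈ K', ρ σ v' = v') :
    antisymmetrizer H (ρ.tprod τ) (v ⊗ₜ[k] w) = antisymmetrizer H (ρ.tprod τ) (v' ⊗ₜ[k] w') := by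
  trans antisymmetrizer H (ρ.tprod τ) (v' ⊗ₜ[k] w)
  · refine antisymmetrizer_congr_of_le hKH ?_
    simp only [antisymmetrizer_tmul_of_fixed_right _ hw, hv]
  · refine antisymmetrizer_congr_of_le hK'H ?_
    simp only [antisymmetrizer_tmul_of_fixed_left _ hv', hw']

end Antisymmetrizer

section PermutationBasis

variable {ι k V X Y : Type*} [Fintype ι] [DecidableEq ι] [CommRing k] [Nontrivial k]
  [AddCommGroup V] [Module k V] [MulAction (Equiv.Perm ι) X] [MulAction (Equiv.Perm ι) Y]
  {ρ : Representation k (Equiv.Perm ι) V} {H : Subgroup (Equiv.Perm ι)}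

theorem antisymmetrizer_basis_ne_zero (b : Module.Basis X k V)
    (hb : ∀ σ x, ρ σ (b x) = b (σ • x)) {x : X}
    (hx : Disjoint H (stabilizer (Equiv.Perm ι) x)) : antisymmetrizer H ρ (b x) ≠ 0 := by
  classical
  have coord_eq_one : b.coord x (antisymmetrizer H ρ (b x)) = 1 := by
    rw [antisymmetrizer_apply, map_sum, Finset.sum_eq_single 1]
    · simp
    · intro σ _ ne_one
      have smul_ne : (σ : Equiv.Perm ι) • x ≠ x := fun h =>
        ne_one (Subtype.ext (Subgroup.disjoint_def.mp hx σ.2 h))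
      simp [Units.smul_def, hb, Finsupp.single_eq_of_ne' smul_ne]
    · simp
  intro h
  simp [h] at coord_eq_one

theorem antisymmetrizer_single_ne_zero {x : X} (hx : Disjoint H (stabilizer (Equiv.Perm ι) x)) :
    antisymmetrizer H (ofMulAction k (Equiv.Perm ι) X) (MonoidAlgebra.single x 1) ≠ 0 := by
  simpa using antisymmetrizer_basis_ne_zero (MonoidAlgebra.basis X k)
    (fun σ y => by simp [ofMulAction_single]) hx

theorem antisymmetrizer_single_tmul_single_ne_zero {x : X} {y : Y}
    (hxy : Disjoint H (stabilizer (Equiv.Perm ι) x ⊓ stabilizer (Equiv.Perm ι) y)) :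
    antisymmetrizer H
      ((ofMulAction k (Equiv.Perm ι) X).tprod (ofMulAction k (Equiv.Perm ι) Y))
      (MonoidAlgebra.single x 1 ⊗ₜ MonoidAlgebra.single y 1) ≠ 0 := by
  have stabilizer_pair : stabilizer (Equiv.Perm ι) (x, y) =
      stabilizer (Equiv.Perm ι) x ⊓ stabilizer (Equiv.Perm ι) y := by
    ext σ
    simp [mem_stabilizer_iff]
  simpa [Module.Basis.tensorProduct_apply'] using antisymmetrizer_basis_ne_zero
    (ρ := (ofMulAction k (Equiv.Perm ι) X).tprod (ofMulAction k (Equiv.Perm ι) Y))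
    ((MonoidAlgebra.basis X k).tensorProduct (MonoidAlgebra.basis Y k))
    (fun σ z => by simp [Module.Basis.tensorProduct_apply', ofMulAction_single])
    (stabilizer_pair ▸ hxy)

end PermutationBasis

section YoungSubgroup

variable {ι κ κ' : Type*} {f : ι → κ} {g : ι → κ'}

/-- The Young subgroup of the partition of `ι` into the fibres of `f`: the permutations that
preserve every fibre. -/
def youngSubgroup (f : ι → κ) : Subgroup (Equiv.Perm ι) where
  carrier := {σ | ∀ x, f (σ x) = f x}
  mul_mem' hσ hτ x := (hσ _).trans (hτ x)
  one_mem' _ := rfl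
  inv_mem' {σ} hσ x := by simpa using (hσ (σ⁻¹ x)).symm

theorem mem_youngSubgroup {σ : Equiv.Perm ι} : σ ∈ youngSubgroup f ↔ ∀ x, f (σ x) = f x := Iff.rfl

theorem youngSubgroup_le_of_factorsThrough (h : g.FactorsThrough f) :
    youngSubgroup f ≤ youngSubgroup g :=
  fun _ hσ x => h (hσ x)

theorem youngSubgroup_prodMk : youngSubgroup (fun x => (f x, g x)) =
    youngSubgroup f ⊓ youngSubgroup g := by
  ext σ
  simp [mem_youngSubgroup, forall_and]

theorem disjoint_youngSubgroup_of_injective (h : Function.Injective fun x => (f x, g x)) :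
    Disjoint (youngSubgroup f) (youngSubgroup g) :=
  Subgroup.disjoint_def.mpr fun hf hg =>
    Equiv.ext fun x => h (Prod.ext (hf x) (hg x))

theorem swap_mem_youngSubgroup [DecidableEq ι] {x y : ι} (h : f x = f y) :
    Equiv.swap x y ∈ youngSubgroup f := by
  intro z
  rcases eq_or_ne z x with rfl | hx
  · rw [Equiv.swap_apply_left, h]
  rcases eq_or_ne z y with rfl | hy
  · rw [Equiv.swap_apply_right, h]
  · rw [Equiv.swap_apply_of_ne_of_ne hx hy]

end YoungSubgroup

section Subrepresentations

variable {G k V : Type*} [Monoid G] [CommRing k] [AddCommGroup V] [Module k V]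
  {ρ : Representation k G V}

/-- The inclusion of a subrepresentation, as an intertwining map. -/
def subrepInclusion (U : Subrepresentation ρ) : U.toRepresentation.IntertwiningMap ρ :=
  LinearMap.intertwiningMap_of_isIntertwiningMap _ _ U.toSubmodule.subtype fun _ _ => rfl

theorem isCompl_toSubmodule {U U' : Subrepresentation ρ} (h : IsCompl U U') :
    IsCompl U.toSubmodule U'.toSubmodule :=
  ⟨disjoint_iff.mpr (congrArg Subrepresentation.toSubmodule h.inf_eq_bot),
    codisjoint_iff.mpr (congrArg Subrepresentation.toSubmodule h.sup_eq_top)⟩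

end Subrepresentations

section Semisimple

variable {G k V : Type*} [Monoid G] [Field k] [AddCommGroup V] [Module k V]
  {ρ : Representation k G V}

theorem exists_intertwiningMap_retraction [IsSemisimpleRepresentation ρ]
    (U : Subrepresentation ρ) :
    ∃ p : ρ.IntertwiningMap U.toRepresentation, ∀ u : U.toSubmodule, p u = u := by
  obtain ⟨U', hU⟩ := exists_isCompl U
  have compl := isCompl_toSubmodule hU
  refine ⟨LinearMap.intertwiningMap_of_isIntertwiningMap _ _
    (Submodule.projectionOnto _ _ compl) fun g v => ?_, Submodule.projectionOnto_apply_left compl⟩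
  obtain ⟨u, u', rfl⟩ : ∃ (u : U.toSubmodule) (u' : U'.toSubmodule), (u : V) + u' = v :=
    ⟨_, _, Submodule.projection_add_projection_eq_self compl v⟩
  have map_left : ρ g u = (U.toRepresentation g u : U.toSubmodule) := rfl
  have map_right : ρ g u' = (U'.toRepresentation g u' : U'.toSubmodule) := rfl
  simp only [map_add, map_left, map_right, Submodule.projectionOnto_apply_left,
    Submodule.projectionOnto_apply_right, add_zero]

theorem isIrreducible_of_generator [IsSemisimpleRepresentation ρ] {e : V}
    (he : ∀ U : Subrepresentation ρ, e ∈ U.toSubmodule → U = ⊤) (κ : V →ₗ[k] V)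
    (hκ : ∀ U : Subrepresentation ρ, ∀ v ∈ U.toSubmodule, κ v ∈ U.toSubmodule)
    (hspan : ∀ v, κ v ∈ k ∙ e) (hne : κ e ≠ 0) : ρ.IsIrreducible where
  exists_pair_ne := ⟨⊥, ⊤, fun h => hne <| by
    have mem_bot : e ∈ (⊥ : Subrepresentation ρ).toSubmodule := h ▸ Submodule.mem_top
    rw [(Submodule.mem_bot k).mp mem_bot, map_zero]⟩
  eq_bot_or_eq_top U := by
    have eq_top_of_map_ne_zero (U : Subrepresentation ρ) {u : V} (hu : u ∈ U.toSubmodule)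
        (hκu : κ u ≠ 0) : U = ⊤ := by
      obtain ⟨c, hc⟩ := Submodule.mem_span_singleton.mp (hspan u)
      have c_ne_zero : c ≠ 0 := by
        rintro rfl
        exact hκu (by rw [← hc, zero_smul])
      refine he U ((U.toSubmodule.smul_mem_iff c_ne_zero).mp ?_)
      exact hc ▸ hκ U u hu
    obtain ⟨U', hU⟩ := exists_isCompl U
    obtain ⟨u, u', hu, hu', rfl⟩ :=
      Submodule.codisjoint_iff_exists_add_eq.mp (isCompl_toSubmodule hU).codisjoint e
    rcases eq_or_ne (κ u) 0 with hκu | hκu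
    · have hκu' : κ u' ≠ 0 := by rwa [map_add, hκu, zero_add] at hne
      obtain rfl := eq_top_of_map_ne_zero U' hu' hκu'
      exact .inl (eq_bot_of_isCompl_top hU)
    · exact .inr (eq_top_of_map_ne_zero U hu hκu)

end Semisimple

theorem exists_intertwiningMap_ofMulAction {G k W X : Type*} [Group G] [CommSemiring k]
    [AddCommMonoid W] [Module k W] {τ : Representation k G W} [MulAction G X] [IsPretransitive G X]
    (x₀ : X) {w : W} (hw : ∀ g ∈ stabilizer G x₀, τ g w = w) :
    ∃ f : (ofMulAction k G X).IntertwiningMap τ, f (MonoidAlgebra.single x₀ 1) = w := by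
  choose g hg using exists_smul_eq G x₀
  have orbit_map (h : G) : τ (g (h • x₀)) w = τ h w := by
    have mem_stabilizer : h⁻¹ * g (h • x₀) ∈ stabilizer G x₀ := by
      rw [mem_stabilizer_iff, mul_smul, hg, inv_smul_smul]
    conv_rhs => rw [← hw _ mem_stabilizer, ← Module.End.mul_apply, ← map_mul, mul_inv_cancel_left]
  let f : MonoidAlgebra k X →ₗ[k] W := (MonoidAlgebra.basis X k).constr k fun x => τ (g x) w
  have f_single (x : X) : f (MonoidAlgebra.single x 1) = τ (g x) w := by
    simpa using (MonoidAlgebra.basis X k).constr_basis k (fun x => τ (g x) w) x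
  have f_single_smul (h : G) : f (MonoidAlgebra.single (h • x₀) 1) = τ h w := by
    rw [f_single, orbit_map]
  refine ⟨LinearMap.intertwiningMap_of_isIntertwiningMap _ _ f fun h v => ?_, ?_⟩
  · suffices f ∘ₗ ofMulAction k G X h = τ h ∘ₗ f from LinearMap.congr_fun this v
    refine (MonoidAlgebra.basis X k).ext fun x => ?_
    obtain ⟨h', rfl⟩ := exists_smul_eq G x₀ x
    simp [ofMulAction_single, smul_smul, f_single_smul]
  · simpa using f_single_smul 1

section Tableaux

open Finset

variable {μ : YoungDiagram} {N : ℕ}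

namespace Tabloid

/-- The row of a tabloid in which an entry stands. -/
def rowIdx (s : Tabloid μ N) (x : Fin N) : ℕ := s.1 x

theorem rowIdx_smul (σ : Equiv.Perm (Fin N)) (s : Tabloid μ N) (x : Fin N) :
    (σ • s).rowIdx x = s.rowIdx (σ⁻¹ x) := rfl

theorem rowIdx_injective : Function.Injective (rowIdx : Tabloid μ N → Fin N → ℕ) :=
  Subtype.val_injective

theorem card_rowIdx_eq (s : Tabloid μ N) (i : ℕ) : #{x | s.rowIdx x = i} = μ.rowLen i := s.2 i

theorem card_rowIdx_lt (s : Tabloid μ N) (h : ℕ) :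
    #{x | s.rowIdx x < h} = ∑ i ∈ range h, μ.rowLen i := by
  rw [card_eq_sum_card_fiberwise (f := s.rowIdx) (t := range h) (by intro; simp)]
  refine sum_congr rfl fun i hi => ?_
  rw [← s.card_rowIdx_eq i, filter_filter]
  congr 1 with x
  grind

theorem stabilizer_eq (s : Tabloid μ N) :
    stabilizer (Equiv.Perm (Fin N)) s = youngSubgroup s.rowIdx := by
  ext σ
  rw [← inv_mem_iff, mem_stabilizer_iff, ← rowIdx_injective.eq_iff, funext_iff]
  simp only [rowIdx_smul, inv_inv, mem_youngSubgroup]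

theorem exists_tabloid_eq (s : Tabloid μ N) : ∃ T : BijTableau μ N, T.tabloid = s := by
  have card_fiber (i : ℕ) : Fintype.card {c : {c // c ∈ μ.cells} // c.1.1 = i} =
      Fintype.card {x // s.rowIdx x = i} := by
    rw [Fintype.card_subtype, ← card_map (Function.Embedding.subtype _), Fintype.card_subtype,
      s.card_rowIdx_eq, YoungDiagram.rowLen_eq_card]
    congr 1 with c
    simpa [YoungDiagram.mem_row_iff] using and_comm
  let T : BijTableau μ N := Equiv.ofFiberEquiv fun i => Fintype.equivOfCardEq (card_fiber i)
  refine ⟨T, rowIdx_injective (funext fun x => ?_)⟩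
  have rowIdx_T (c) : s.rowIdx (T c) = c.1.1 := Equiv.ofFiberEquiv_map _ c
  rw [← T.apply_symm_apply x, rowIdx_T, T.apply_symm_apply]
  rfl

instance : IsPretransitive (Equiv.Perm (Fin N)) (Tabloid μ N) where
  exists_smul_eq s s' := by
    obtain ⟨T, rfl⟩ := exists_tabloid_eq s
    obtain ⟨T', rfl⟩ := exists_tabloid_eq s'
    refine ⟨T.symm.trans T', ?_⟩
    rw [← BijTableau.tabloid_trans, ← Equiv.trans_assoc, Equiv.self_trans_symm, Equiv.refl_trans]

end Tabloid

namespace BijTableau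

/-- The column of a tableau in which an entry stands. -/
def colIdx (T : BijTableau μ N) (x : Fin N) : ℕ := (T.symm x).1.2

/-- The column group of a tableau, as a subgroup. -/
abbrev columnSubgroup (T : BijTableau μ N) : Subgroup (Equiv.Perm (Fin N)) :=
  youngSubgroup T.colIdx

theorem cell_mem (T : BijTableau μ N) (x : Fin N) : (T.tabloid.rowIdx x, T.colIdx x) ∈ μ :=
  (T.symm x).2

theorem cell_injective (T : BijTableau μ N) :
    Function.Injective fun x => (T.tabloid.rowIdx x, T.colIdx x) :=
  Subtype.val_injective.comp T.symm.injective

theorem exists_cell_eq (T : BijTableau μ N) {i j : ℕ} (h : (i, j) ∈ μ) :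
    ∃ x, T.tabloid.rowIdx x = i ∧ T.colIdx x = j :=
  ⟨T ⟨(i, j), h⟩, by simp [Tabloid.rowIdx, tabloid], by simp [colIdx]⟩

theorem card_rowIdx_lt_colIdx_eq (T : BijTableau μ N) (h j : ℕ) :
    #{x | T.tabloid.rowIdx x < h ∧ T.colIdx x = j} = min h (μ.colLen j) := by
  rw [← card_range (min h _)]
  refine card_bij (fun x _ => T.tabloid.rowIdx x) (fun x hx => ?_) (fun x hx y hy hxy => ?_)
    fun i hi => ?_
  · have := μ.mem_iff_lt_colLen.mp (T.cell_mem x)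
    grind
  · exact T.cell_injective (by grind)
  · obtain ⟨x, rfl, rfl⟩ :=
      T.exists_cell_eq (μ.mem_iff_lt_colLen.mpr (lt_min_iff.mp (mem_range.mp hi)).2)
    exact ⟨x, by grind, rfl⟩

theorem card_colIdx_eq (T : BijTableau μ N) (j : ℕ) : #{x | T.colIdx x = j} = μ.colLen j := by
  have rowIdx_lt {x} (hx : T.colIdx x = j) : T.tabloid.rowIdx x < μ.colLen j :=
    hx ▸ μ.mem_iff_lt_colLen.mp (T.cell_mem x)
  rw [← min_self (μ.colLen j), ← T.card_rowIdx_lt_colIdx_eq]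
  congr 1 with x
  simpa using rowIdx_lt

theorem card_rowIdx_lt_colIdx_eq_le (T : BijTableau μ N) {s : Tabloid μ N}
    (hs : Function.Injective fun x => (s.rowIdx x, T.colIdx x)) (h j : ℕ) :
    #{x | s.rowIdx x < h ∧ T.colIdx x = j} ≤ min h (μ.colLen j) := by
  refine le_min ?_ ?_
  · rw [← card_range h]
    refine card_le_card_of_injOn s.rowIdx (fun x hx => ?_) fun x hx y hy hxy => ?_
    · simp_all
    · exact hs (by grind)
  · rw [← T.card_colIdx_eq j]
    exact card_le_card fun x => by grind

theorem rowIdx_lt_colLen (T : BijTableau μ N) {s : Tabloid μ N}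
    (hs : Function.Injective fun x => (s.rowIdx x, T.colIdx x)) (x : Fin N) :
    s.rowIdx x < μ.colLen (T.colIdx x) := by
  -- The column bounds of `card_rowIdx_lt_colIdx_eq_le` add up to the exact number of entries in the
  -- first `h` rows, so all of them are attained.
  set h := μ.colLen (T.colIdx x) with h_def
  have card_lt_eq_sum (r : Tabloid μ N) : #{y | r.rowIdx y < h} =
      ∑ j ∈ univ.image T.colIdx, #{y | r.rowIdx y < h ∧ T.colIdx y = j} := by
    rw [card_eq_sum_card_fiberwise (f := T.colIdx) (t := univ.image T.colIdx) (by intro; simp)]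
    simp only [filter_filter]
  have sum_eq := (card_lt_eq_sum s).symm.trans
    ((s.card_rowIdx_lt h).trans ((T.tabloid.card_rowIdx_lt h).symm.trans (card_lt_eq_sum _)))
  simp only [card_rowIdx_lt_colIdx_eq] at sum_eq
  have card_column : #{y | s.rowIdx y < h ∧ T.colIdx y = T.colIdx x} =
      #{y | T.colIdx y = T.colIdx x} := by
    rw [(sum_eq_sum_iff_of_le fun j _ => T.card_rowIdx_lt_colIdx_eq_le hs h j).mp sum_eq _
      (mem_image_of_mem _ (mem_univ x)), card_colIdx_eq, ← h_def, min_self]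
  have filter_eq := eq_of_subset_of_card_le (fun y => by grind) card_column.ge
  have mem_filter : x ∈ filter (fun y => s.rowIdx y < h ∧ T.colIdx y = T.colIdx x) univ :=
    filter_eq ▸ by simp
  exact (mem_filter_univ x).mp mem_filter |>.1

theorem exists_smul_eq_tabloid (T : BijTableau μ N) {s : Tabloid μ N}
    (hs : Function.Injective fun x => (s.rowIdx x, T.colIdx x)) :
    ∃ σ ∈ T.columnSubgroup, σ • s = T.tabloid := by
  choose f f_row f_col using fun x =>
    T.exists_cell_eq (μ.mem_iff_lt_colLen.mpr (T.rowIdx_lt_colLen hs x))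
  have f_injective : Function.Injective f := fun x y hxy =>
    hs (by grind)
  let σ : Equiv.Perm (Fin N) := Equiv.ofBijective f (Finite.injective_iff_bijective.mp f_injective)
  refine ⟨σ, f_col, Tabloid.rowIdx_injective (funext fun x => ?_)⟩
  rw [Tabloid.rowIdx_smul, ← f_row]
  exact congrArg _ (σ.apply_symm_apply x)

theorem polytabloid_eq_antisymmetrizer (T : BijTableau μ N) :
    T.polytabloid =
      antisymmetrizer T.columnSubgroup (tabloidRep μ N) (MonoidAlgebra.single T.tabloid 1) := by
  classical
  have mem_columnGroup (σ) : σ ∈ T.columnGroup ↔ σ ∈ T.columnSubgroup := by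
    simp [columnGroup, mem_youngSubgroup, colIdx]
  simp only [polytabloid, antisymmetrizer_apply, ofMulAction_single, Units.smul_def,
    MonoidAlgebra.smul_single, zsmul_one]
  exact sum_subtype T.columnGroup mem_columnGroup _

theorem polytabloid_ne_zero (T : BijTableau μ N) : T.polytabloid ≠ 0 := by
  rw [polytabloid_eq_antisymmetrizer]
  refine antisymmetrizer_single_ne_zero ?_
  rw [T.tabloid.stabilizer_eq]
  exact (disjoint_youngSubgroup_of_injective T.cell_injective).symm

theorem antisymmetrizer_mem_span_polytabloid (T : BijTableau μ N) (v) :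
    antisymmetrizer T.columnSubgroup (tabloidRep μ N) v ∈ Submodule.span ℂ {T.polytabloid} := by
  suffices LinearMap.range (antisymmetrizer T.columnSubgroup (tabloidRep μ N)) ≤
      Submodule.span ℂ {T.polytabloid} from this ⟨v, rfl⟩
  rw [LinearMap.range_eq_map, ← (MonoidAlgebra.basis _ ℂ).span_eq, Submodule.map_span_le]
  rintro _ ⟨s, rfl⟩
  rw [MonoidAlgebra.basis_apply]
  by_cases hs : Function.Injective fun x => (s.rowIdx x, T.colIdx x)
  · obtain ⟨σ, hσ, σ_smul⟩ := T.exists_smul_eq_tabloid hs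
    have polytabloid_eq := antisymmetrizer_apply_of_mem (ρ := tabloidRep μ N) hσ
      (MonoidAlgebra.single s 1)
    rw [ofMulAction_single, σ_smul, ← polytabloid_eq_antisymmetrizer,
      ← inv_smul_eq_iff] at polytabloid_eq
    rw [← polytabloid_eq, Units.smul_def]
    exact zsmul_mem (Submodule.mem_span_singleton_self _) _
  · obtain ⟨x, y, hxy, ne⟩ := Function.not_injective_iff.mp hs
    have := IsAddTorsionFree.of_isTorsionFree ℂ (MonoidAlgebra ℂ (Tabloid μ N))
    have swap_smul : Equiv.swap x y • s = s := by
      rw [← mem_stabilizer_iff, s.stabilizer_eq]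
      exact swap_mem_youngSubgroup (congrArg Prod.fst hxy)
    rw [antisymmetrizer_eq_zero_of_swap ne (swap_mem_youngSubgroup (congrArg Prod.snd hxy))
      (by rw [ofMulAction_single, swap_smul])]
    exact Submodule.zero_mem _

theorem polytabloid_mem_spechtSubrep (T : BijTableau μ N) :
    T.polytabloid ∈ (spechtSubrep μ N).toSubmodule :=
  Submodule.subset_span ⟨T, rfl⟩

theorem spechtSubrep_eq_top_of_polytabloid_mem (T : BijTableau μ N)
    (U : Subrepresentation (spechtSubrep μ N).toRepresentation)
    (hU : ⟨T.polytabloid, T.polytabloid_mem_spechtSubrep⟩ ∈ U.toSubmodule) : U = ⊤ := by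
  have le_map : (spechtSubrep μ N).toSubmodule ≤ U.toSubmodule.map (Submodule.subtype _) := by
    refine Submodule.span_le.mpr ?_
    rintro _ ⟨T', rfl⟩
    have trans_eq : T.trans (T.symm.trans T') = T' := by
      rw [← Equiv.trans_assoc, Equiv.self_trans_symm, Equiv.refl_trans]
    refine ⟨_, U.apply_mem_toSubmodule (T.symm.trans T') hU, ?_⟩
    exact (T.tabloidRep_polytabloid _).trans (congrArg polytabloid trans_eq)
  refine Subrepresentation.toSubmodule_injective (Submodule.eq_top_iff'.mpr fun v => ?_)
  obtain ⟨u, hu, u_eq⟩ := le_map v.2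
  exact Subtype.ext u_eq ▸ hu

theorem spechtSubrep_isIrreducible (T : BijTableau μ N) :
    (spechtSubrep μ N).toRepresentation.IsIrreducible := by
  have coe_antisymmetrizer (v : (spechtSubrep μ N).toSubmodule) :
      (antisymmetrizer T.columnSubgroup (spechtSubrep μ N).toRepresentation v :
        MonoidAlgebra ℂ (Tabloid μ N)) = antisymmetrizer T.columnSubgroup (tabloidRep μ N) v :=
    map_antisymmetrizer (subrepInclusion _) v
  refine isIrreducible_of_generator T.spechtSubrep_eq_top_of_polytabloid_mem
    (antisymmetrizer T.columnSubgroup (spechtSubrep μ N).toRepresentation)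
    (fun U v hv => antisymmetrizer_mem U hv) (fun v => ?_) ?_
  · obtain ⟨c, hc⟩ := Submodule.mem_span_singleton.mp (T.antisymmetrizer_mem_span_polytabloid v)
    exact Submodule.mem_span_singleton.mpr ⟨c, Subtype.ext (hc.trans (coe_antisymmetrizer v).symm)⟩
  · have antisymmetrizer_eq : antisymmetrizer T.columnSubgroup (tabloidRep μ N) T.polytabloid =
        Nat.card T.columnSubgroup • T.polytabloid := by
      rw [polytabloid_eq_antisymmetrizer, antisymmetrizer_antisymmetrizer le_rfl]
    rw [← Subtype.coe_ne_coe, coe_antisymmetrizer, antisymmetrizer_eq, ← Nat.cast_smul_eq_nsmul ℂ]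
    exact smul_ne_zero (Nat.cast_ne_zero.mpr Nat.card_pos.ne') T.polytabloid_ne_zero

theorem spechtSubrep_appearsIn_of_antisymmetrizer_ne_zero {W : Type*} [AddCommGroup W] [Module ℂ W]
    {τ : Representation ℂ (Equiv.Perm (Fin N)) W} (T : BijTableau μ N) {w : W}
    (hw : ∀ σ ∈ stabilizer (Equiv.Perm (Fin N)) T.tabloid, τ σ w = w)
    (hne : antisymmetrizer T.columnSubgroup τ w ≠ 0) :
    AppearsIn (spechtSubrep μ N).toRepresentation τ := by
  obtain ⟨f, hf⟩ := exists_intertwiningMap_ofMulAction T.tabloid hw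
  have := T.spechtSubrep_isIrreducible
  refine ⟨f.comp (subrepInclusion _),
    (IsIrreducible.injective_or_eq_zero _).resolve_right fun comp_eq_zero => hne ?_⟩
  have apply_polytabloid : f T.polytabloid = 0 :=
    congrArg (fun f => f ⟨T.polytabloid, T.polytabloid_mem_spechtSubrep⟩) comp_eq_zero
  rw [← hf, ← map_antisymmetrizer, ← polytabloid_eq_antisymmetrizer, apply_polytabloid]

theorem antisymmetrizer_retraction (A : BijTableau μ N)
    {p : (tabloidRep μ N).IntertwiningMap (spechtSubrep μ N).toRepresentation}
    (hp : ∀ u : (spechtSubrep μ N).toSubmodule, p u = u) :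
    antisymmetrizer A.columnSubgroup (tabloidRep μ N) (p (MonoidAlgebra.single A.tabloid 1)) =
      antisymmetrizer A.columnSubgroup (tabloidRep μ N) (MonoidAlgebra.single A.tabloid 1) := by
  refine (map_antisymmetrizer ((subrepInclusion _).comp p) (MonoidAlgebra.single _ 1)).symm.trans ?_
  rw [← A.polytabloid_eq_antisymmetrizer]
  exact congrArg Subtype.val (hp ⟨_, A.polytabloid_mem_spechtSubrep⟩)

theorem spechtSubrep_appearsIn_tprod {ξ ν : YoungDiagram} (A : BijTableau μ N)
    (B : BijTableau ν N) (T : BijTableau ξ N)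
    (hTA : stabilizer (Equiv.Perm (Fin N)) T.tabloid ≤ stabilizer _ A.tabloid)
    (hTB : stabilizer (Equiv.Perm (Fin N)) T.tabloid ≤ stabilizer _ B.tabloid)
    (hAT : A.columnSubgroup ≤ T.columnSubgroup) (hAB : A.columnSubgroup ≤ stabilizer _ B.tabloid)
    (hBT : B.columnSubgroup ≤ T.columnSubgroup) (hBA : B.columnSubgroup ≤ stabilizer _ A.tabloid)
    (hdisj : Disjoint T.columnSubgroup (stabilizer _ A.tabloid ⊓ stabilizer _ B.tabloid)) :
    AppearsIn (spechtSubrep ξ N).toRepresentation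
      ((spechtSubrep μ N).toRepresentation.tprod (spechtSubrep ν N).toRepresentation) := by
  obtain ⟨p, hp⟩ := exists_intertwiningMap_retraction (spechtSubrep μ N)
  obtain ⟨q, hq⟩ := exists_intertwiningMap_retraction (spechtSubrep ν N)
  set a : MonoidAlgebra ℂ (Tabloid μ N) := MonoidAlgebra.single A.tabloid 1
  set b : MonoidAlgebra ℂ (Tabloid ν N) := MonoidAlgebra.single B.tabloid 1
  have fixed_a {σ} (hσ : σ ∈ stabilizer _ A.tabloid) : tabloidRep μ N σ a = a := by
    rw [ofMulAction_single, mem_stabilizer_iff.mp hσ]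
  have fixed_b {σ} (hσ : σ ∈ stabilizer _ B.tabloid) : tabloidRep ν N σ b = b := by
    rw [ofMulAction_single, mem_stabilizer_iff.mp hσ]
  have fixed_qb {σ} (hσ : σ ∈ stabilizer _ B.tabloid) :
      (spechtSubrep ν N).toRepresentation σ (q b) = q b := by rw [← q.isIntertwining, fixed_b hσ]
  refine T.spechtSubrep_appearsIn_of_antisymmetrizer_ne_zero (w := p a ⊗ₜ q b) (fun σ hσ => ?_) ?_
  · rw [Representation.tprod_apply, TensorProduct.map_tmul, ← p.isIntertwining, fixed_a (hTA hσ),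
      fixed_qb (hTB hσ)]
  · intro eq_zero
    have := IsAddTorsionFree.of_isTorsionFree ℂ
      (MonoidAlgebra ℂ (Tabloid μ N) ⊗[ℂ] MonoidAlgebra ℂ (Tabloid ν N))
    refine antisymmetrizer_single_tmul_single_ne_zero (k := ℂ) hdisj ?_
    rw [← antisymmetrizer_tmul_congr hAT hBT (A.antisymmetrizer_retraction hp)
      (fun σ hσ => congrArg Subtype.val (fixed_qb (hAB hσ))) (B.antisymmetrizer_retraction hq)
      fun σ hσ => fixed_a (hBA hσ)]
    have map_eq := map_antisymmetrizer (H := T.columnSubgroup)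
      ((subrepInclusion (spechtSubrep μ N)).tensor (subrepInclusion (spechtSubrep ν N)))
      (p a ⊗ₜ q b)
    rw [eq_zero, map_zero] at map_eq
    exact map_eq.symm

/-- The tableau of the transposed shape whose rows are the columns of `T`. -/
def transpose (T : BijTableau μ.transpose N) : BijTableau μ N :=
  ((Equiv.prodComm ℕ ℕ).subtypeEquiv fun c => by simp).trans T

end BijTableau

theorem exists_equiv_fin_antitone {Q α : Type*} [Fintype Q] [LinearOrder α] (f : Q → α) :
    ∃ e : Q ≃ Fin (Fintype.card Q), ∀ q q', e q ≤ e q' → f q' ≤ f q := by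
  let e := Fintype.equivFin Q
  let f' : Fin (Fintype.card Q) → αᵒᵈ := OrderDual.toDual ∘ f ∘ e.symm
  refine ⟨e.trans (Tuple.sort f').symm, fun q q' h => ?_⟩
  simpa [f'] using Tuple.monotone_sort f' h

namespace Tabloid

theorem exists_bijTableau_of_cells (s : Tabloid μ N) {col : Fin N → ℕ}
    (hmem : ∀ x, (s.rowIdx x, col x) ∈ μ) (hinj : Function.Injective fun x => (s.rowIdx x, col x)) :
    ∃ A : BijTableau μ N, A.tabloid = s ∧ A.colIdx = col := by
  let cell (x : Fin N) : {c // c ∈ μ.cells} := ⟨(s.rowIdx x, col x), hmem x⟩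
  have cell_injective : Function.Injective cell := fun x y h => hinj (Subtype.ext_iff.mp h)
  obtain ⟨T, -⟩ := s.exists_tabloid_eq
  have cell_bijective : Function.Bijective cell :=
    (Fintype.bijective_iff_injective_and_card cell).mpr ⟨cell_injective, Fintype.card_congr T.symm⟩
  exact ⟨(Equiv.ofBijective cell cell_bijective).symm, rfl, rfl⟩

theorem exists_columns_of_nested {κ : Type*} (s : Tabloid μ N) {c : Fin N → κ}
    (hnest : ∀ x, ∀ i < s.rowIdx x, ∃ y, s.rowIdx y = i ∧ c y = c x) :
    ∃ col : Fin N → ℕ, c.FactorsThrough col ∧ ∀ x, (s.rowIdx x, col x) ∈ μ := by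
  classical
  -- Sorted by decreasing length, the fibres of `c` fit into the columns of `μ`.
  let length (q : Set.range c) : ℕ := ({x | c x = q} : Finset (Fin N)).sup (s.rowIdx · + 1)
  have lt_length (x : Fin N) : s.rowIdx x < length (Set.rangeFactorization c x) :=
    le_sup (f := (s.rowIdx · + 1)) ((mem_filter_univ x).mpr rfl)
  have exists_of_lt_length {q : Set.range c} {i : ℕ} (hi : i < length q) :
      ∃ y, s.rowIdx y = i ∧ c y = q := by
    obtain ⟨x, hx, lt⟩ := Finset.lt_sup_iff.mp hi
    rw [← (mem_filter_univ x).mp hx]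
    rcases (Nat.lt_succ_iff.mp lt).eq_or_lt with rfl | lt
    · exact ⟨x, rfl, rfl⟩
    · exact hnest x i lt
  obtain ⟨e, he⟩ := exists_equiv_fin_antitone length
  let col (x : Fin N) : Fin _ := e (Set.rangeFactorization c x)
  refine ⟨fun x => col x, fun x y h => congrArg Subtype.val (e.injective (Fin.ext h)), fun x => ?_⟩
  rw [YoungDiagram.mem_iff_lt_rowLen, ← s.card_rowIdx_eq, ← Nat.add_one_le_iff, ← Fin.card_Iic]
  refine card_le_card_of_surjOn col fun j hj => ?_
  obtain ⟨y, row_y, col_y⟩ := exists_of_lt_length (q := e.symm j)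
    ((lt_length x).trans_le (he _ _ (by simpa using hj)))
  have col_eq : Set.rangeFactorization c y = e.symm j := Subtype.ext col_y
  exact ⟨y, by simpa using row_y, by simp only [col, col_eq, e.apply_symm_apply]⟩

end Tabloid

theorem BijTableau.exists_of_nested {κ : Type*} {row : Fin N → ℕ} {c : Fin N → κ}
    (hcard : ∀ i, #{x | row x = i} = μ.rowLen i) (hinj : Function.Injective fun x => (row x, c x))
    (hnest : ∀ x, ∀ i < row x, ∃ y, row y = i ∧ c y = c x) :
    ∃ A : BijTableau μ N, A.tabloid.rowIdx = row ∧ A.columnSubgroup ≤ youngSubgroup c := by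
  let s : Tabloid μ N := ⟨row, hcard⟩
  obtain ⟨col, c_factors, col_mem⟩ := s.exists_columns_of_nested hnest
  obtain ⟨A, hA, rfl⟩ := s.exists_bijTableau_of_cells col_mem fun x y h =>
    hinj (Prod.ext (Prod.ext_iff.mp h).1 (c_factors (Prod.ext_iff.mp h).2))
  exact ⟨A, congrArg Tabloid.rowIdx hA, youngSubgroup_le_of_factorsThrough c_factors⟩

end Tableaux

theorem coe_rowLens_partitionDiagram {N : ℕ} (p : N.Partition) :
    ((partitionDiagram p).rowLens : Multiset ℕ) = p.parts := by
  rw [partitionDiagram, YoungDiagram.rowLens_ofRowLens_eq_self, Multiset.sort_eq]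
  exact fun x hx => p.parts_pos (by simpa using hx)

theorem countP_lt_rowLens (μ : YoungDiagram) (k : ℕ) : μ.rowLens.countP (k < ·) = μ.colLen k := by
  have count_eq : μ.rowLens.countP (k < ·) =
      {i ∈ Finset.range (μ.colLen 0) | k < μ.rowLen i}.card := by
    rw [YoungDiagram.rowLens, List.countP_map, List.countP_eq_length_filter]
    rfl
  rw [count_eq, ← Finset.card_range (μ.colLen k)]
  congr 1 with i
  rw [Finset.mem_filter, Finset.mem_range, Finset.mem_range, ← YoungDiagram.mem_iff_lt_rowLen,
    ← YoungDiagram.mem_iff_lt_colLen, ← YoungDiagram.mem_iff_lt_colLen, and_iff_right_iff_imp]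
  exact fun h => μ.up_left_mem le_rfl (Nat.zero_le k) h

namespace PartsAre

open Finset

variable {N : ℕ} {p : N.Partition}

theorem sum_eq {ι : Type*} [Fintype ι] {f : ι → ℕ} (h : PartsAre p f) : ∑ i, f i = N := by
  rw [← p.parts_sum, h]
  exact (Nat.Partition.ofMultiset (univ.val.map f)).parts_sum.symm

theorem card_lt_eq_colLen {ι : Type*} [Fintype ι] {f : ι → ℕ} (h : PartsAre p f) (k : ℕ) :
    #{i | k < f i} = (partitionDiagram p).colLen k := by
  have and_ne_zero (v : ℕ) : k < v ∧ v ≠ 0 ↔ k < v := and_iff_left_of_imp Nat.ne_zero_of_lt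
  rw [← countP_lt_rowLens, ← Multiset.coe_countP, coe_rowLens_partitionDiagram, h,
    Multiset.countP_filter, Multiset.countP_map]
  simp only [and_ne_zero]
  rfl

theorem rowLen_eq {m : ℕ} {f : Fin m → ℕ} (h : PartsAre p f) (hf : Antitone f) (i : Fin m) :
    (partitionDiagram p).rowLen i = f i := by
  refine eq_of_forall_lt_iff fun k => ?_
  rw [← YoungDiagram.mem_iff_lt_rowLen, YoungDiagram.mem_iff_lt_colLen, ← h.card_lt_eq_colLen k]
  exact Fin.lt_card_filter_univ_iff_apply_of_imp (fun i => k < f i)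
    fun a b hab hb => hb.trans_le (hf hab)

theorem rowLen_eq_zero {m : ℕ} {f : Fin m → ℕ} (h : PartsAre p f) {i : ℕ} (hi : m ≤ i) :
    (partitionDiagram p).rowLen i = 0 := by
  by_contra ne_zero
  have lt_colLen : i < (partitionDiagram p).colLen 0 := by
    rwa [← YoungDiagram.mem_iff_lt_colLen, YoungDiagram.mem_iff_lt_rowLen, Nat.pos_iff_ne_zero]
  have card_le := card_le_univ ({i | 0 < f i} : Finset (Fin m))
  rw [h.card_lt_eq_colLen, Fintype.card_fin] at card_le
  omega

end PartsAre

/-- An enumeration by `Fin N` of the boxes `(i, j, k)`, `k < t i j`, of the three-dimensional stack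
with `t i j` boxes over the position `(i, j)`. -/
structure BoxEnumeration {ι κ : Type*} (t : ι → κ → ℕ) (N : ℕ) where
  row : Fin N → ι
  col : Fin N → κ
  height : Fin N → ℕ
  injective : Function.Injective fun x => (row x, col x, height x)
  exists_iff : ∀ i j k, (∃ x, row x = i ∧ col x = j ∧ height x = k) ↔ k < t i j

namespace BoxEnumeration

open Finset

variable {ι κ : Type*} {t : ι → κ → ℕ} {N : ℕ}

theorem nonempty [Fintype ι] [Fintype κ] (h : ∑ c : ι × κ, t c.1 c.2 = N) :
    Nonempty (BoxEnumeration t N) := by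
  have card_boxes : Fintype.card (Σ c : ι × κ, Fin (t c.1 c.2)) = N := by simpa using h
  let b := (Fintype.equivFinOfCardEq card_boxes).symm
  refine ⟨⟨fun x => (b x).1.1, fun x => (b x).1.2, fun x => (b x).2, fun x y h => ?_,
    fun i j k => ⟨?_, fun hk => ?_⟩⟩⟩
  · simp only [Prod.mk.injEq] at h
    exact b.injective (Sigma.ext (Prod.ext h.1 h.2.1) ((Fin.heq_ext_iff (by grind)).mpr h.2.2))
  · rintro ⟨x, rfl, rfl, rfl⟩
    exact (b x).2.2
  · exact ⟨b.symm ⟨(i, j), k, hk⟩, by simp, by simp, by rw [b.apply_symm_apply]⟩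

/-- The enumeration of the boxes of the stack seen from the other side. -/
def swap (E : BoxEnumeration t N) : BoxEnumeration (fun j i => t i j) N where
  row := E.col
  col := E.row
  height := E.height
  injective x y h := E.injective (by simp_all)
  exists_iff j i k := by
    rw [← E.exists_iff i j k]
    simp only [and_left_comm]

theorem height_lt (E : BoxEnumeration t N) (x : Fin N) : E.height x < t (E.row x) (E.col x) :=
  (E.exists_iff _ _ _).mp ⟨x, rfl, rfl, rfl⟩

theorem card_row_eq [Fintype κ] [DecidableEq ι] (E : BoxEnumeration t N) (i : ι) :
    #{x | E.row x = i} = ∑ j, t i j := by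
  classical
  rw [card_eq_sum_card_fiberwise (f := E.col) (t := univ) (by simp)]
  refine sum_congr rfl fun j _ => ?_
  rw [filter_filter, ← card_range (t i j)]
  refine card_bij (fun x _ => E.height x) (fun x hx => ?_) (fun x hx y hy h => ?_) fun k hk => ?_
  · have := E.height_lt x
    grind
  · exact E.injective (by grind)
  · obtain ⟨x, hx⟩ := (E.exists_iff i j k).mpr (mem_range.mp hk)
    exact ⟨x, by grind⟩

theorem card_height_eq [Fintype ι] [Fintype κ] (E : BoxEnumeration t N) (k : ℕ) :
    #{x | E.height x = k} = #{c : ι × κ | k < t c.1 c.2} := by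
  refine card_bij (fun x _ => (E.row x, E.col x)) (fun x hx => ?_) (fun x hx y hy h => ?_)
    fun c hc => ?_
  · have := E.height_lt x
    grind
  · exact E.injective (by grind)
  · obtain ⟨x, hx⟩ := (E.exists_iff c.1 c.2 k).mpr ((mem_filter_univ c).mp hc)
    exact ⟨x, by grind⟩

theorem exists_bijTableau_row {m : ℕ} [Fintype κ] {t : Fin m → κ → ℕ} {p : N.Partition}
    (E : BoxEnumeration t N) (ht : ∀ j, Antitone fun i => t i j)
    (hp : PartsAre p fun i => ∑ j, t i j) :
    ∃ A : BijTableau (partitionDiagram p) N,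
      stabilizer (Equiv.Perm (Fin N)) A.tabloid = youngSubgroup E.row ∧
        A.columnSubgroup ≤ youngSubgroup E.col ⊓ youngSubgroup E.height := by
  have card_row (i : ℕ) : #{x | (E.row x : ℕ) = i} = (partitionDiagram p).rowLen i := by
    rcases lt_or_ge i m with hi | hi
    · rw [hp.rowLen_eq (fun a b hab => sum_le_sum fun j _ => ht j hab) ⟨i, hi⟩, ← E.card_row_eq]
      simp only [Fin.ext_iff]
    · rw [hp.rowLen_eq_zero hi, card_eq_zero, filter_eq_empty_iff]
      exact fun x _ => ((E.row x).2.trans_le hi).ne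
  obtain ⟨A, hA, columns_le⟩ := BijTableau.exists_of_nested
    (c := fun x => (E.col x, E.height x)) card_row (fun x y h => E.injective (by grind))
    fun x i hi => by
      obtain ⟨y, hy⟩ := (E.exists_iff ⟨i, hi.trans (E.row x).2⟩ (E.col x) (E.height x)).mpr
        ((E.height_lt x).trans_le (ht _ hi.le))
      exact ⟨y, congrArg Fin.val hy.1, Prod.ext hy.2.1 hy.2.2⟩
  refine ⟨A, ?_, youngSubgroup_prodMk ▸ columns_le⟩
  ext σ
  simp [A.tabloid.stabilizer_eq, hA, mem_youngSubgroup, Fin.ext_iff]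

theorem exists_bijTableau_height [Fintype ι] [Fintype κ] {p : N.Partition}
    (E : BoxEnumeration t N) (hp : PartsAre p fun c : ι × κ => t c.1 c.2) :
    ∃ T : BijTableau (partitionDiagram p) N,
      stabilizer (Equiv.Perm (Fin N)) T.tabloid ≤ youngSubgroup E.row ⊓ youngSubgroup E.col ∧
        T.columnSubgroup = youngSubgroup E.height := by
  have card_height (k : ℕ) :
      #{x | E.height x = k} = (partitionDiagram p).transpose.rowLen k := by
    rw [E.card_height_eq, hp.card_lt_eq_colLen, YoungDiagram.rowLen_transpose]
  obtain ⟨A, hA, columns_le⟩ := BijTableau.exists_of_nested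
    (c := fun x => (E.row x, E.col x)) card_height (fun x y h => E.injective (by grind))
    fun x k hk => by
      obtain ⟨y, hy⟩ := (E.exists_iff (E.row x) (E.col x) k).mpr (hk.trans (E.height_lt x))
      exact ⟨y, hy.2.2, Prod.ext hy.1 hy.2.1⟩
  refine ⟨A.transpose, ?_, congrArg youngSubgroup hA⟩
  rw [Tabloid.stabilizer_eq, ← youngSubgroup_prodMk]
  exact columns_le

end BoxEnumeration

/-- Fill an `m × n` tableau `t` with the parts of `γ` (and zeros), weakly decreasingly along rows
and columns, and let `α` and `β` be the row sums and the column sums. Then `[γ]` appears in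
`[α] ⊗ [β]`. -/
theorem mainTheorem7 (m n N : ℕ) (γ α β : N.Partition) (t : Fin m → Fin n → ℕ)
    (hrow : ∀ i, Antitone fun j => t i j)
    (hcol : ∀ j, Antitone fun i => t i j)
    (hγ : PartsAre γ fun c : Fin m × Fin n => t c.1 c.2)
    (hα : PartsAre α fun i => ∑ j, t i j)
    (hβ : PartsAre β fun j => ∑ i, t i j) :
    AppearsIn (spechtRep γ) (Representation.tprod (spechtRep α) (spechtRep β)) := by
  obtain ⟨E⟩ := BoxEnumeration.nonempty hγ.sum_eq
  obtain ⟨A, rows_A, columns_A⟩ := E.exists_bijTableau_row hcol hα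
  obtain ⟨B, rows_B, columns_B⟩ := E.swap.exists_bijTableau_row hrow hβ
  obtain ⟨T, rows_T, columns_T⟩ := E.exists_bijTableau_height hγ
  have rows_columns_disjoint : Disjoint (youngSubgroup E.height)
      (youngSubgroup E.row ⊓ youngSubgroup E.col) := by
    rw [← youngSubgroup_prodMk]
    exact disjoint_youngSubgroup_of_injective fun x y h => E.injective (by grind)
  refine BijTableau.spechtSubrep_appearsIn_tprod A B T ?_ ?_ ?_ ?_ ?_ ?_ ?_ <;>
    simp only [rows_A, rows_B, columns_T]
  exacts [rows_T.trans inf_le_left, rows_T.trans inf_le_right, columns_A.trans inf_le_right,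
    columns_A.trans inf_le_left, columns_B.trans inf_le_right, columns_B.trans inf_le_left,
    rows_columns_disjoint]
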